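/- Let $A\in M_n(\mathbb C)$, $B\in M_m(\mathbb C)$, $c\in\mathbb R^n$, $d\in\mathbb R^m$. For $\theta\in[0,2\pi)$ put $H_\theta(A)=\frac12(e^{i\theta}A+e^{-i\theta}A^*)$, let $\lambda_1(H)\ge\lambda_2(H)\ge\cdots$ denote the eigenvalues of a Hermitian matrix $H$ in decreasing order, and put $$h_{A,c}(\theta)=\sum_{j=1}^n c_j\lambda_j(H_\theta(A)),\qquad L_{A,c}(\theta)=\{v\in\mathbb C:\ \mathrm{Re}\,(e^{i\theta}v)=h_{A,c}(\theta)\}.$$ For any $M\in M_n(\mathbb C)$ with eigenvalues $\lambda_1(M),\dots,\lambda_n(M)$ (listed with algebraic multiplicity), a *$c$-value* of $M$ is a number $\sum_j w_j\lambda_j(M)$, where $w$ is a rearrangement of the entries of $c$. The *$c$-polynomial* of $M$ is $p(M;c)(t)=\prod_w\bigl(t-\sum_j w_j\lambda_j(M)\bigr)$, the product being taken over the pairwise different rearrangements $w$ of $c$. Put $\deg(M;c)=\deg p(M;c)$, and let $r(A;c)\in\mathbb C[x,y,t]$ be the polynomial given by $r(A;c)(x,y,t)=p(xA+yA^*;c)(t)$.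 Use the same notation for $B$ and $d$. Suppose that there are $\deg(A;c)\deg(B;d)+1$ values $\theta\in[0,2\pi)$, whose lines $L_{A,c}(\theta)$ are pairwise distinct, for which $$\sum_{j=1}^n c_j\lambda_j(H_\theta(A))=\sum_{k=1}^m d_k\lambda_k(H_\theta(B)).$$ Then some $c$-value of $A$ is a $d$-value of $B$. If moreover $r(A;c)$ is irreducible in $\mathbb C[x,y,t]$, then every $c$-value of $A$ is a $d$-value of $B$. -/

import Mathlib

open scoped Matrix

namespace WeightedNumericalRange

/-- `H_θ(A) = (e^{iθ} A + e^{-iθ} A*) / 2`. -/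
noncomputable def rotatedRealPart {n : ℕ} (A : Matrix (Fin n) (Fin n) ℂ) (θ : ℝ) :
    Matrix (Fin n) (Fin n) ℂ :=
  (1 / 2 : ℂ) • (Complex.exp (Complex.I * θ) • A + Complex.exp (-(Complex.I * θ)) • Aᴴ)

theorem rotatedRealPart_isHermitian {n : ℕ} (A : Matrix (Fin n) (Fin n) ℂ) (θ : ℝ) :
    (rotatedRealPart A θ).IsHermitian := by
  unfold rotatedRealPart Matrix.IsHermitian
  rw [Matrix.conjTranspose_smul, Matrix.conjTranspose_add, Matrix.conjTranspose_smul,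
    Matrix.conjTranspose_smul, Matrix.conjTranspose_conjTranspose, add_comm]
  simp [← Complex.exp_conj]

/-- The eigenvalues `λ_1(H) ≥ ⋯ ≥ λ_n(H)` of a Hermitian matrix, in decreasing order
(and with multiplicity). -/
noncomputable def sortedEigenvalue {n : ℕ} {H : Matrix (Fin n) (Fin n) ℂ} (hH : H.IsHermitian)
    (j : Fin n) : ℝ :=
  hH.eigenvalues₀ (Fin.cast (Fintype.card_fin n).symm j)

/-- `c_1 λ_1(H_θ(A)) + ⋯ + c_n λ_n(H_θ(A))`. -/
noncomputable def weightedSupport {n : ℕ} (A : Matrix (Fin n) (Fin n) ℂ) (c : Fin n → ℝ)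
    (θ : ℝ) : ℝ :=
  ∑ j, c j * sortedEigenvalue (rotatedRealPart_isHermitian A θ) j

/-- The line `{v ∈ ℂ : Re (e^{iθ} v) = c_1 λ_1(H_θ(A)) + ⋯ + c_n λ_n(H_θ(A))}`. -/
def weightedLine {n : ℕ} (A : Matrix (Fin n) (Fin n) ℂ) (c : Fin n → ℝ) (θ : ℝ) : Set ℂ :=
  {v | (Complex.exp (Complex.I * θ) * v).re = weightedSupport A c θ}

theorem exists_eigenvalues {n : ℕ} (A : Matrix (Fin n) (Fin n) ℂ) :
    ∃ l : Fin n → ℂ, A.charpoly = ∏ j, (Polynomial.X - Polynomial.C (l j)) := by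
  have hs := IsAlgClosed.splits A.charpoly
  have hcard : A.charpoly.roots.toList.length = n := by
    rw [Multiset.length_toList, ← hs.natDegree_eq_card_roots, A.charpoly_natDegree_eq_dim,
      Fintype.card_fin]
  refine ⟨fun j => A.charpoly.roots.toList.get (Fin.cast hcard.symm j), ?_⟩
  have h1 := hs.eq_prod_roots_of_monic A.charpoly_monic
  have h2 : Multiset.map (fun j => A.charpoly.roots.toList.get (Fin.cast hcard.symm j))
      (Finset.univ : Finset (Fin n)).val = A.charpoly.roots := by
    rw [Fin.univ_val_map]
    conv_rhs => rw [← Multiset.coe_toList A.charpoly.roots]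
    congr 1
    apply List.ext_get
    · simp [hcard]
    · intro k h1 h2
      simp
  conv_lhs => rw [h1, ← h2]
  rw [Multiset.map_map]
  rfl

/-- The eigenvalues `λ_1(A), …, λ_n(A)` of an arbitrary complex matrix, listed with algebraic
multiplicity in some order. The notions below do not depend on that order. -/
noncomputable def eigenvalue {n : ℕ} (A : Matrix (Fin n) (Fin n) ℂ) : Fin n → ℂ :=
  (exists_eigenvalues A).choose

/-- The pairwise different rearrangements of the weight vector `c`. They index the generically
distinct `c`-values: as linear forms in indeterminates `λ_1, …, λ_n`, the sums
`∑ c_i λ_{j_i}` over the nonzero entries `c_i`, with pairwise distinct indices `j_i`, are exactly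
the `∑ w_j λ_j` for `w` a rearrangement of `c`, and different `w` give different forms. -/
noncomputable def arrangements {n : ℕ} (c : Fin n → ℝ) : Finset (Fin n → ℝ) :=
  Finset.univ.image fun σ : Equiv.Perm (Fin n) => c ∘ σ

/-- `z` is a `c`-value of `A`. -/
def IsCValue {n : ℕ} (A : Matrix (Fin n) (Fin n) ℂ) (c : Fin n → ℝ) (z : ℂ) : Prop :=
  ∃ w ∈ arrangements c, z = ∑ j, (w j : ℂ) * eigenvalue A j

/-- The `c`-polynomial `p(A;c)(t)`, with one root for each generically distinct `c`-value. -/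
noncomputable def cPoly {n : ℕ} (A : Matrix (Fin n) (Fin n) ℂ) (c : Fin n → ℝ) :
    Polynomial ℂ :=
  ∏ w ∈ arrangements c,
    (Polynomial.X - Polynomial.C (∑ j, (w j : ℂ) * eigenvalue A j))

/-- `deg(A;c) = deg p(A;c)(t)`. -/
noncomputable def cDeg {n : ℕ} (A : Matrix (Fin n) (Fin n) ℂ) (c : Fin n → ℝ) : ℕ :=
  (cPoly A c).natDegree

theorem exists_symmetric_expression {S : Type*} [CommRing S] {n : ℕ} (c : Fin n → ℝ)
    (f : ℝ → S) (a : S) :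
    ∃ q : MvPolynomial (Fin n) S,
      MvPolynomial.aeval (fun i : Fin n => MvPolynomial.esymm (Fin n) S (i + 1)) q =
        ∏ w ∈ arrangements c,
          (MvPolynomial.C a - ∑ j, MvPolynomial.C (f (w j)) * MvPolynomial.X j) := by
  have hg : (∏ w ∈ arrangements c, (MvPolynomial.C a -
      ∑ j, MvPolynomial.C (f (w j)) * MvPolynomial.X j) :
        MvPolynomial (Fin n) S).IsSymmetric := by
    intro σ
    simp only [map_prod, map_sub, map_sum, map_mul, MvPolynomial.rename_C,
      MvPolynomial.rename_X]
    refine Finset.prod_bij' (fun w _ => w ∘ σ.symm) (fun w _ => w ∘ σ) ?_ ?_ ?_ ?_ ?_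
    · intro w hw
      simp only [arrangements, Finset.mem_image, Finset.mem_univ, true_and] at hw ⊢
      obtain ⟨τ, rfl⟩ := hw
      exact ⟨σ.symm.trans τ, rfl⟩
    · intro w hw
      simp only [arrangements, Finset.mem_image, Finset.mem_univ, true_and] at hw ⊢
      obtain ⟨τ, rfl⟩ := hw
      exact ⟨σ.trans τ, rfl⟩
    · intro w _; ext; simp
    · intro w _; ext; simp
    · intro w _
      congr 1
      exact Fintype.sum_equiv σ _ _ (fun j => by simp)
  obtain ⟨q, hq⟩ := MvPolynomial.esymmAlgHom_surjective S (σ := Fin n) (n := n)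
    (Fintype.card_fin n).le ⟨_, hg⟩
  refine ⟨q, ?_⟩
  rw [← MvPolynomial.esymmAlgHom_apply, hq]

theorem map_charpoly_coeff {S : Type*} [CommRing S] {n : ℕ} (φ : S →+* ℂ)
    (M : Matrix (Fin n) (Fin n) S) (l : Fin n → ℂ)
    (hl : (M.map φ).charpoly = ∏ j, (Polynomial.X - Polynomial.C (l j))) (i : Fin n) :
    φ ((-1) ^ (i.val + 1) * M.charpoly.coeff (n - (i.val + 1))) =
      MvPolynomial.eval₂ φ l (MvPolynomial.esymm (Fin n) S (i + 1)) := by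
  have h1 : φ (M.charpoly.coeff (n - (i.val + 1))) =
      (M.map φ).charpoly.coeff (n - (i.val + 1)) := by
    rw [Matrix.charpoly_map M φ, Polynomial.coeff_map]
  have h2 := Multiset.prod_X_sub_C_coeff
    (Multiset.map l (Finset.univ : Finset (Fin n)).val) (k := n - (i.val + 1)) (by simp)
  rw [Multiset.map_map] at h2
  have h3 : (M.map φ).charpoly = (Multiset.map ((fun t => Polynomial.X - Polynomial.C t) ∘ l)
    (Finset.univ : Finset (Fin n)).val).prod := hl
  have h4 : n - (n - (i.val + 1)) = i.val + 1 := by omega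
  rw [map_mul, h1, h3, h2]
  simp only [Multiset.card_map, Finset.card_val, Finset.card_univ, Fintype.card_fin, h4,
    map_pow, map_neg, map_one]
  rw [← mul_assoc, ← mul_pow, neg_one_mul, neg_neg, one_pow, one_mul,
    ← MvPolynomial.aeval_esymm_eq_multiset_esymm (Fin n) ℂ]
  simp [MvPolynomial.esymm, MvPolynomial.eval₂_sum, MvPolynomial.eval₂_prod]

theorem map_eval_charpoly_coeff {S : Type*} [CommRing S] {n : ℕ} (φ : S →+* ℂ)
    (M : Matrix (Fin n) (Fin n) S) (l : Fin n → ℂ)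
    (hl : (M.map φ).charpoly = ∏ j, (Polynomial.X - Polynomial.C (l j)))
    (q : MvPolynomial (Fin n) S) :
    φ (MvPolynomial.eval (fun i : Fin n => (-1) ^ (i.val + 1) *
      M.charpoly.coeff (n - (i.val + 1))) q) = MvPolynomial.eval₂ φ l
        (MvPolynomial.aeval (fun i : Fin n => MvPolynomial.esymm (Fin n) S (i + 1)) q) := by
  induction q using MvPolynomial.induction_on with
  | C a => simp
  | add p q hp hq => rw [map_add, map_add, hp, hq, map_add, MvPolynomial.eval₂_add]
  | mul_X p i hp =>
    rw [map_mul, map_mul, hp, map_mul, MvPolynomial.eval₂_mul, MvPolynomial.eval_X,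
      map_charpoly_coeff φ M l hl i, MvPolynomial.aeval_X]

/-- `p(xA + yA*;c)(t)` is a polynomial in `x, y, t`. -/
theorem exists_rPoly {n : ℕ} (A : Matrix (Fin n) (Fin n) ℂ) (c : Fin n → ℝ) :
    ∃ r : MvPolynomial (Fin 3) ℂ, ∀ x y t : ℂ,
      MvPolynomial.eval ![x, y, t] r = (cPoly (x • A + y • Aᴴ) c).eval t := by
  obtain ⟨q, hq⟩ := exists_symmetric_expression (S := MvPolynomial (Fin 3) ℂ) c
    (fun u => MvPolynomial.C (u : ℂ)) (MvPolynomial.X 2)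
  refine ⟨MvPolynomial.eval (fun i : Fin n => (-1) ^ (i.val + 1) *
    Polynomial.coeff (Matrix.charpoly
      ((MvPolynomial.X 0 : MvPolynomial (Fin 3) ℂ) • A.map MvPolynomial.C +
        (MvPolynomial.X 1 : MvPolynomial (Fin 3) ℂ) • Aᴴ.map MvPolynomial.C :
          Matrix (Fin n) (Fin n) (MvPolynomial (Fin 3) ℂ))) (n - (i.val + 1))) q, fun x y t => ?_⟩
  rw [map_eval_charpoly_coeff (MvPolynomial.eval ![x, y, t]) _
    (eigenvalue (x • A + y • Aᴴ)) ?_ q, hq]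
  · rw [← MvPolynomial.coe_eval₂Hom, map_prod, cPoly, Polynomial.eval_prod]
    refine Finset.prod_congr rfl fun w _ => ?_
    simp [Polynomial.eval_finsetSum]
  · rw [show Matrix.map _ (MvPolynomial.eval ![x, y, t]) = x • A + y • Aᴴ by
      ext i j; simp]
    exact (exists_eigenvalues (x • A + y • Aᴴ)).choose_spec

/-- The polynomial `r(A;c)(x,y,t) = p(xA + yA*;c)(t)` in the three variables `x, y, t`
(determined uniquely by its values, `ℂ` being infinite). -/
noncomputable def rPoly {n : ℕ} (A : Matrix (Fin n) (Fin n) ℂ) (c : Fin n → ℝ) :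
    MvPolynomial (Fin 3) ℂ :=
  (exists_rPoly A c).choose

theorem rPoly_eval {n : ℕ} (A : Matrix (Fin n) (Fin n) ℂ) (c : Fin n → ℝ) (x y t : ℂ) :
    MvPolynomial.eval ![x, y, t] (rPoly A c) = (cPoly (x • A + y • Aᴴ) c).eval t :=
  (exists_rPoly A c).choose_spec x y t

end WeightedNumericalRange

/-! ### Homogeneity and factors of forms. -/

namespace MvPolynomial

/-! The polynomial $r(A;c)$ is a form of degree $\deg(A;c)$, equal to 1 at $(0,0,1)$, and the zeros
$z$ of $r(A;c)(1,0,z)$ are the $c$-values of $A$. Each line $L_{A,c}(\theta)$ gives a projective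
zero $(e^{i\theta}/2, e^{-i\theta}/2, h_{A,c}(\theta))$, and distinct lines give distinct points.
Where the weighted sums agree, this is also a zero of $r(B;d)$. So the two forms have more than
$\deg(A;c)\deg(B;d)$ common zeros, and by Bézout (`card_common_zeros_le_mul_of_isRelPrime`) they
share a nonconstant factor.

Such a factor is a form not vanishing at $(0,0,1)$, so it meets the line $y=0$ in some $(1,0,z)$
(`exists_eval_eq_zero_of_dvd`), and $z$ is a common value. If $r(A;c)$ is irreducible, it divides
$r(B;d)$ and all its zeros on $y=0$ are shared. -/

theorem IsHomogeneous.eval_smul {σ R : Type*} [CommRing R] {p : MvPolynomial σ R} {k : ℕ}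
    (hp : p.IsHomogeneous k) (a : R) (v : σ → R) :
    eval (a • v) p = a ^ k * eval v p := by
  rw [eval_eq, eval_eq, Finset.mul_sum]
  refine Finset.sum_congr rfl fun d hd => ?_
  have h : ∏ i ∈ d.support, a ^ d i = a ^ k := by
    rw [Finset.prod_pow_eq_pow_sum, hp.degree_eq_sum_deg_support hd]
  simp only [Pi.smul_apply, smul_eq_mul, mul_pow, Finset.prod_mul_distrib, h]
  ring

/-- The substitution `X i ↦ X i * T`, which records degrees as powers of `T`. -/
noncomputable def scaleHom (σ R : Type*) [CommRing R] :
    MvPolynomial σ R →ₐ[R] Polynomial (MvPolynomial σ R) :=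
  aeval fun i => Polynomial.C (X i) * Polynomial.X

theorem scaleHom_eval_one {σ R : Type*} [CommRing R] (p : MvPolynomial σ R) :
    (scaleHom σ R p).eval 1 = p := by
  induction p using MvPolynomial.induction_on with
  | C a => simp [scaleHom, Polynomial.algebraMap_apply]
  | add p q hp hq => simp [hp, hq]
  | mul_X p i hp => rw [map_mul, Polynomial.eval_mul, hp]; simp [scaleHom]

theorem scaleHom_monomial {σ R : Type*} [CommRing R] (d : σ →₀ ℕ) (a : R) :
    scaleHom σ R (monomial d a) = Polynomial.C (monomial d a) * Polynomial.X ^ d.degree := by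
  rw [scaleHom, aeval_monomial, monomial_eq, Finsupp.prod, Finsupp.prod]
  simp only [mul_pow, Finset.prod_mul_distrib, Finset.prod_pow_eq_pow_sum, map_mul, map_prod,
    map_pow, Polynomial.algebraMap_apply, algebraMap_eq, Finsupp.degree_apply]
  rw [mul_assoc]

/-- The coefficient of $T^i$ in `scaleHom σ R p` is the degree $i$ part of `p`, so homogeneity
becomes a statement about polynomials in one variable. -/
theorem isHomogeneous_iff_scaleHom {σ R : Type*} [CommRing R] {p : MvPolynomial σ R} {k : ℕ} :
    p.IsHomogeneous k ↔ scaleHom σ R p = Polynomial.monomial k p := by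
  have key : scaleHom σ R p =
      ∑ d ∈ p.support, Polynomial.monomial d.degree (monomial d (p.coeff d)) := by
    conv_lhs => rw [p.as_sum]
    rw [map_sum]
    exact Finset.sum_congr rfl fun d _ => by
      rw [scaleHom_monomial, Polynomial.C_mul_X_pow_eq_monomial]
  constructor
  · intro hp
    rw [key]
    conv_rhs => rw [p.as_sum, map_sum]
    refine Finset.sum_congr rfl fun d hd => ?_
    rw [hp.degree_eq_sum_deg_support hd, Finsupp.degree_apply]
  · intro h
    classical
    rw [key] at h
    intro d hd
    by_contra hne
    replace hne : d.degree ≠ k := by rwa [Finsupp.degree_eq_weight_one]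
    have h1 := congrArg (fun q => coeff d (q.coeff d.degree)) h
    simp only [Polynomial.finsetSum_coeff, Polynomial.coeff_monomial, coeff_sum] at h1
    rw [if_neg (fun h => hne h.symm), coeff_zero, Finset.sum_eq_single d] at h1
    · rw [if_pos rfl, coeff_monomial, if_pos rfl] at h1; exact hd h1
    · intro e _ he
      split_ifs
      · rw [coeff_monomial, if_neg he]
      · simp
    · intro h; simp at h; exact absurd h hd

/-- Over a domain, both the degree and the trailing degree in $T$ are additive. They agree for the
product, hence for each factor. -/
theorem IsHomogeneous.exists_of_mul {σ R : Type*} [CommRing R] [IsDomain R]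
    {p q : MvPolynomial σ R} {k : ℕ} (h : (p * q).IsHomogeneous k) (h0 : p * q ≠ 0) :
    ∃ i j, p.IsHomogeneous i ∧ q.IsHomogeneous j ∧ i + j = k := by
  have hp0 : p ≠ 0 := left_ne_zero_of_mul h0
  have hq0 : q ≠ 0 := right_ne_zero_of_mul h0
  have h1 := isHomogeneous_iff_scaleHom.1 h
  rw [map_mul] at h1
  have hne : ∀ r : MvPolynomial σ R, r ≠ 0 → scaleHom σ R r ≠ 0 := fun r hr h => hr <| by
    rw [← scaleHom_eval_one r, h, Polynomial.eval_zero]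
  have hd := congrArg Polynomial.natDegree h1
  have ht := congrArg Polynomial.natTrailingDegree h1
  rw [Polynomial.natDegree_mul (hne p hp0) (hne q hq0),
    Polynomial.natDegree_monomial_eq _ h0] at hd
  rw [Polynomial.natTrailingDegree_mul (hne p hp0) (hne q hq0),
    Polynomial.natTrailingDegree_monomial h0] at ht
  have hp1 := Polynomial.natTrailingDegree_le_natDegree (scaleHom σ R p)
  have hq1 := Polynomial.natTrailingDegree_le_natDegree (scaleHom σ R q)
  have main : ∀ r : MvPolynomial σ R,
      (scaleHom σ R r).natTrailingDegree = (scaleHom σ R r).natDegree →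
      r.IsHomogeneous (scaleHom σ R r).natDegree := by
    intro r hr
    have hm : scaleHom σ R r = Polynomial.monomial (scaleHom σ R r).natDegree
        ((scaleHom σ R r).coeff (scaleHom σ R r).natDegree) := by
      ext1 i
      rw [Polynomial.coeff_monomial]
      split_ifs with hi
      · rw [hi]
      · rcases lt_or_gt_of_ne hi with hi | hi
        · exact Polynomial.coeff_eq_zero_of_natDegree_lt hi
        · exact Polynomial.coeff_eq_zero_of_lt_natTrailingDegree (hr ▸ hi)
    rw [isHomogeneous_iff_scaleHom]
    have h2 := scaleHom_eval_one r
    rw [hm, Polynomial.eval_monomial, one_pow, mul_one] at h2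
    rwa [h2] at hm
  exact ⟨_, _, main p (by omega), main q (by omega), hd⟩

theorem isHomogeneous_of_eval_smul {σ K : Type*} [Field K] [Infinite K]
    {p : MvPolynomial σ K} {k : ℕ}
    (h : ∀ a : K, a ≠ 0 → ∀ v : σ → K, eval (a • v) p = a ^ k * eval v p) :
    p.IsHomogeneous k := by
  rw [isHomogeneous_iff_scaleHom]
  ext1 i
  refine MvPolynomial.funext fun v => ?_
  have key : (scaleHom σ K p).map (eval v) = Polynomial.monomial k (eval v p) := by
    refine Polynomial.eq_of_infinite_eval_eq _ _ ?_
    refine (Set.finite_singleton (0 : K)).infinite_compl.mono fun a ha => ?_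
    have h1 : ((scaleHom σ K p).map (eval v)).eval a = eval (a • v) p := by
      clear h
      induction p using MvPolynomial.induction_on with
      | C a => simp [scaleHom, Polynomial.algebraMap_apply]
      | add p q hp hq => simp [hp, hq]
      | mul_X p i hp =>
        rw [map_mul, Polynomial.map_mul, Polynomial.eval_mul, hp]; simp [scaleHom, mul_comm a]
    simp only [Set.mem_ofPred_eq, h1, h a ha v, Polynomial.eval_monomial]
    ring
  have h2 := congrArg (Polynomial.coeff · i) key
  simp only [Polynomial.coeff_map, Polynomial.coeff_monomial] at h2
  rw [h2, Polynomial.coeff_monomial]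
  split_ifs <;> simp

/-! ### Bézout's bound by dimension count. -/

theorem finrank_homogeneousSubmodule_fin_three (K : Type*) [Field K] (k : ℕ) :
    Module.finrank K (homogeneousSubmodule (Fin 3) K k) = (k + 2).choose 2 := by
  have hs : homogeneousSubmodule (Fin 3) K k =
      restrictSupport K {d : Fin 3 →₀ ℕ | d.degree = k} :=
    homogeneousSubmodule_eq_finsupp_supported _ _ k
  rw [hs, Module.finrank_eq_nat_card_basis (basisRestrictSupport K {d : Fin 3 →₀ ℕ | d.degree = k})]
  have h : {d : Fin 3 →₀ ℕ | d.degree = k} =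
      ↑(Finset.univ.finsuppAntidiag k : Finset (Fin 3 →₀ ℕ)) := by
    ext d
    simp [Finset.mem_finsuppAntidiag, Finsupp.degree_eq_sum]
  rw [h, Nat.card_coe_set_eq, Set.ncard_coe_finset, Finset.card_finsuppAntidiag_nat_eq_choose]
  rw [Finset.card_univ, Fintype.card_fin, show 3 + k - 1 = k + 2 by omega,
    ← Nat.choose_symm_of_eq_add rfl, Nat.add_comm]

/-- Forms of any large enough degree separate points of the affine chart `x₀ = 1`. -/
theorem exists_isHomogeneous_separating {σ K : Type*} [Field K] (i₀ : σ)
    (S : Finset (σ → K)) (hS : ∀ p ∈ S, p i₀ = 1) (p : σ → K) (hp : p ∈ S) {k : ℕ}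
    (hk : S.card ≤ k) :
    ∃ q : MvPolynomial σ K, q.IsHomogeneous k ∧ eval p q = 1 ∧ ∀ s ∈ S, s ≠ p → eval s q = 0 := by
  classical
  have hlin : ∀ s ∈ S, ∃ l : MvPolynomial σ K, l.IsHomogeneous 1 ∧ eval p l = 1 ∧
      (s ≠ p → eval s l = 0) := by
    intro s hs
    by_cases hsp : s = p
    · exact ⟨X i₀, isHomogeneous_X _ _, by simp [hS p hp], fun h => absurd hsp h⟩
    · obtain ⟨i, hi⟩ := Function.ne_iff.1 hsp
      have hi' : p i - s i ≠ 0 := sub_ne_zero.2 (Ne.symm hi)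
      -- A linear form vanishing at `s`, normalized at `p` by a coordinate where the two points
      -- differ.
      refine ⟨C (p i - s i)⁻¹ * (X i - C (s i) * X i₀),
        ((isHomogeneous_X _ _).sub ((isHomogeneous_X _ _).C_mul _)).C_mul _, ?_, ?_⟩
      · simp [hS p hp, hi']
      · simp [hS s hs]
  choose! l hl1 hl2 hl3 using hlin
  -- The power of `X i₀`, which is 1 on the chart, pads the degree to `k`.
  refine ⟨(∏ s ∈ S, l s) * X i₀ ^ (k - S.card), ?_, ?_, ?_⟩
  · have h := (IsHomogeneous.prod S l (fun _ => 1) hl1).mul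
      (isHomogeneous_X_pow (R := K) i₀ (k - S.card))
    rwa [Finset.sum_const, smul_eq_mul, mul_one, Nat.add_sub_of_le hk] at h
  · rw [map_mul, map_prod, Finset.prod_eq_one hl2]
    simp [hS p hp]
  · intro s hs hsp
    rw [map_mul, map_prod, Finset.prod_eq_zero hs (hl3 s hs hsp), zero_mul]

theorem finrank_map_mulLeft_homogeneousSubmodule {K : Type*} [Field K]
    {f : MvPolynomial (Fin 3) K} (hf : f ≠ 0) (k : ℕ) :
    Module.finrank K ((homogeneousSubmodule (Fin 3) K k).map (LinearMap.mulLeft K f)) =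
      (k + 2).choose 2 := by
  rw [← finrank_homogeneousSubmodule_fin_three K k]
  exact LinearEquiv.finrank_eq (Submodule.equivMapOfInjective _
    (mul_right_injective₀ hf) _).symm

instance finiteDimensional_homogeneousSubmodule {σ K : Type*} [Finite σ] [Field K] (k : ℕ) :
    FiniteDimensional K (homogeneousSubmodule σ K k) :=
  Module.Finite.iff_fg.2 (homogeneousSubmodule_fg σ K k)

/-- A weak form of Bézout's theorem: two coprime forms of degrees `a` and `b` in three variables
have at most `a * b` common zeros in the chart `x₀ = 1` of the projective plane. -/
theorem card_common_zeros_le_mul_of_isRelPrime {K : Type*} [Field K]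
    {f g : MvPolynomial (Fin 3) K} {a b : ℕ} (hf : f.IsHomogeneous a) (hg : g.IsHomogeneous b)
    (hf0 : f ≠ 0) (hg0 : g ≠ 0) (hfg : IsRelPrime f g) (S : Finset (Fin 3 → K))
    (hS : ∀ p ∈ S, p 0 = 1) (hSf : ∀ p ∈ S, eval p f = 0) (hSg : ∀ p ∈ S, eval p g = 0) :
    S.card ≤ a * b := by
  classical
  -- Work in degree `k + a + b`: large enough to separate `S`, so evaluation on `S` has rank `k`,
  -- while the multiples of `f` and of `g` lie in its kernel.
  set k := S.card with hk
  let V := fun i => homogeneousSubmodule (Fin 3) K i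
  let F := (V (k + b)).map (LinearMap.mulLeft K f)
  let G := (V (k + a)).map (LinearMap.mulLeft K g)
  let ev : MvPolynomial (Fin 3) K →ₗ[K] (S → K) := LinearMap.pi fun p => (aeval p.1).toLinearMap
  let evV : V (k + a + b) →ₗ[K] (S → K) := ev.domRestrict _
  have hev : ∀ q (p : S), ev q p = eval p.1 q := fun q p => by
    simp [ev, aeval_eq_eval]
  have hsurj : Function.Surjective evV := by
    intro v
    have hsep := fun p : S => exists_isHomogeneous_separating 0 S hS p.1 p.2
      (k := k + a + b) (by omega)
    choose q hq1 hq2 hq3 using hsep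
    refine ⟨⟨∑ p : S, v p • q p, Submodule.sum_mem _ fun p _ =>
      Submodule.smul_mem _ _ (hq1 p)⟩, ?_⟩
    ext s
    rw [LinearMap.domRestrict_apply, hev, map_sum, Finset.sum_eq_single s]
    · simp [hq2]
    · intro p _ hps
      rw [smul_eval, hq3 p s.1 s.2 (fun h => hps (Subtype.ext h.symm)), mul_zero]
    · simp
  have hrange : Module.finrank K (LinearMap.range evV) = k := by
    rw [LinearMap.range_eq_top.2 hsurj, finrank_top, Module.finrank_fintype_fun_eq_card,
      Fintype.card_coe]
  have hrn := evV.finrank_range_add_finrank_ker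
  rw [hrange, finrank_homogeneousSubmodule_fin_three] at hrn
  have hle : F ⊔ G ≤ (LinearMap.ker evV).map (V (k + a + b)).subtype := by
    refine sup_le ?_ ?_
    · rintro _ ⟨q, hq, rfl⟩
      refine ⟨⟨f * q, ?_⟩, ?_, rfl⟩
      · have := hf.mul hq
        rwa [show a + (k + b) = k + a + b by ring] at this
      · refine LinearMap.mem_ker.2 (_root_.funext fun p => ?_)
        rw [LinearMap.domRestrict_apply, hev, map_mul, hSf p.1 p.2, zero_mul, Pi.zero_apply]
    · rintro _ ⟨q, hq, rfl⟩
      refine ⟨⟨g * q, ?_⟩, ?_, rfl⟩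
      · have := hg.mul hq
        rwa [show b + (k + a) = k + a + b by ring] at this
      · refine LinearMap.mem_ker.2 (_root_.funext fun p => ?_)
        rw [LinearMap.domRestrict_apply, hev, map_mul, hSg p.1 p.2, zero_mul, Pi.zero_apply]
  -- By coprimality a common multiple of `f` and `g` is a multiple of `f * g`; the cofactor is again
  -- a form, of degree `k`.
  have hinf : F ⊓ G ≤ (V k).map (LinearMap.mulLeft K (f * g)) := by
    rintro _ ⟨⟨q, hq, rfl⟩, ⟨r, hr, hrq⟩⟩
    simp only [LinearMap.mulLeft_apply] at hrq ⊢
    obtain ⟨s, rfl⟩ : g ∣ q := hfg.symm.dvd_of_dvd_mul_left ⟨r, hrq.symm⟩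
    refine ⟨s, ?_, by simp⟩
    by_cases hs : s = 0
    · rw [hs]; exact Submodule.zero_mem _
    · obtain ⟨i, j, hi, hj, hij⟩ := IsHomogeneous.exists_of_mul hq (mul_ne_zero hg0 hs)
      have := hi.inj_right hg hg0
      rwa [show j = k by omega] at hj
  have h1 : Module.finrank K ↥(F ⊔ G) ≤ Module.finrank K (LinearMap.ker evV) :=
    (Submodule.finrank_mono hle).trans (Submodule.finrank_map_le _ _)
  have h2 : Module.finrank K ↥(F ⊓ G) ≤ (k + 2).choose 2 :=
    (Submodule.finrank_mono hinf).trans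
      (finrank_map_mulLeft_homogeneousSubmodule (mul_ne_zero hf0 hg0) k).le
  have h3 := Submodule.finrank_sup_add_finrank_inf_eq F G
  rw [finrank_map_mulLeft_homogeneousSubmodule hf0,
    finrank_map_mulLeft_homogeneousSubmodule hg0] at h3
  have hchoose : ∀ i : ℕ, (i + 2) * (i + 1) = 2 * (i + 2).choose 2 := fun i => by
    rw [Nat.choose_two_right, Nat.mul_div_cancel' (Nat.even_mul_pred_self _).two_dvd]; rfl
  have c0 := hchoose k
  have c1 := hchoose (k + a)
  have c2 := hchoose (k + b)
  have c3 := hchoose (k + a + b)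
  -- The mixed second difference of $\binom{i+2}{2}$ with steps `a` and `b` is `a * b`, so `F ⊔ G`
  -- has codimension at most `a * b`.
  nlinarith

/-- A nonunit factor of a form `f` with `f(0,0,1) ≠ 0` has a zero on the line `{(1, 0, t)}`. -/
theorem exists_eval_eq_zero_of_dvd {K : Type*} [Field K] [IsAlgClosed K]
    {f h : MvPolynomial (Fin 3) K} {a : ℕ} (hf : f.IsHomogeneous a)
    (hf1 : eval ![0, 0, 1] f ≠ 0) (hhf : h ∣ f) (hh : ¬ IsUnit h) :
    ∃ t : K, eval ![1, 0, t] h = 0 := by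
  have : Infinite K := IsAlgClosed.instInfinite
  obtain ⟨q, rfl⟩ := hhf
  have hne : h * q ≠ 0 := fun h0 => hf1 (by rw [h0, map_zero])
  obtain ⟨e, -, he, -, -⟩ := hf.exists_of_mul hne
  have he0 : e ≠ 0 := by
    rintro rfl
    refine hh (isUnit_iff_totalDegree_of_isReduced.2 ⟨?_, by simpa using he.totalDegree_le⟩)
    rw [isUnit_iff_ne_zero]
    intro hc
    have h1 := totalDegree_eq_zero_iff_eq_C.1 (Nat.le_zero.1 he.totalDegree_le)
    rw [hc, C_0] at h1
    exact hne (by rw [h1, zero_mul])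
  have hh1 : eval ![0, 0, 1] h ≠ 0 := fun h0 => hf1 (by rw [map_mul, h0, zero_mul])
  let P : Polynomial K := aeval ![1, 0, Polynomial.X] h
  let Q : Polynomial K := aeval ![Polynomial.X, 0, 1] h
  have hP : ∀ t, P.eval t = eval ![1, 0, t] h := fun t => by
    have := comp_aeval_apply (R := K) ![1, 0, Polynomial.X] (Polynomial.aeval t) h
    rw [← Polynomial.coe_aeval_eq_eval, this, aeval_eq_eval]
    congr 2
    ext i; fin_cases i <;> simp
  have hQ : ∀ x, Q.eval x = eval ![x, 0, 1] h := fun x => by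
    have := comp_aeval_apply (R := K) ![Polynomial.X, 0, 1] (Polynomial.aeval x) h
    rw [← Polynomial.coe_aeval_eq_eval, this, aeval_eq_eval]
    congr 2
    ext i; fin_cases i <;> simp
  by_contra! hno
  have hdeg : P.degree = 0 := by
    by_contra hd
    obtain ⟨t, ht⟩ := IsAlgClosed.exists_root P hd
    exact hno t (by rw [← hP]; exact ht)
  obtain ⟨u, hu⟩ : ∃ u, P = Polynomial.C u := ⟨_, Polynomial.eq_C_of_degree_eq_zero hdeg⟩
  -- Homogeneity gives $h(x,0,1) = x^e h(1,0,1/x) = u x^e$, which vanishes at $x=0$ since $e>0$.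
  have hQ' : Q = Polynomial.C u * Polynomial.X ^ e := by
    refine Polynomial.eq_of_infinite_eval_eq _ _ ?_
    refine (Set.finite_singleton (0 : K)).infinite_compl.mono fun x hx => ?_
    have hx : x ≠ 0 := hx
    have h1 : ![x, 0, 1] = x • ![1, 0, x⁻¹] := by
      ext i; fin_cases i <;> simp [hx]
    rw [Set.mem_ofPred_eq, hQ, h1, he.eval_smul, ← hP, hu]
    simp only [Polynomial.eval_C, Polynomial.eval_mul, Polynomial.eval_pow, Polynomial.eval_X]
    ring
  refine hh1 ?_
  rw [← hQ, hQ']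
  simp [he0]

end MvPolynomial

theorem Matrix.charpoly_smul_eq_prod {n : ℕ} {K : Type*} [Field K] [Infinite K]
    {M : Matrix (Fin n) (Fin n) K} {l : Fin n → K}
    (hl : M.charpoly = ∏ j, (Polynomial.X - Polynomial.C (l j))) {a : K} (ha : a ≠ 0) :
    (a • M).charpoly = ∏ j, (Polynomial.X - Polynomial.C (a * l j)) := by
  refine Polynomial.funext fun t => ?_
  have h := congrArg (Polynomial.eval (a⁻¹ * t)) hl
  rw [Matrix.eval_charpoly, Polynomial.eval_prod] at h
  rw [Matrix.eval_charpoly, Polynomial.eval_prod]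
  have h1 : Matrix.scalar (Fin n) t - a • M = a • (Matrix.scalar (Fin n) (a⁻¹ * t) - M) := by
    rw [smul_sub]
    congr 1
    ext i j
    simp [Matrix.diagonal_apply, ha]
  rw [h1, Matrix.det_smul, h, Fintype.card_fin, ← Fin.prod_const, ← Finset.prod_mul_distrib]
  refine Finset.prod_congr rfl fun j _ => ?_
  simp [mul_sub, ha]

theorem MvPolynomial.eval_eq_zero_of_dvd {σ R : Type*} [CommRing R] {p q : MvPolynomial σ R}
    (h : p ∣ q) {v : σ → R} (hp : eval v p = 0) : eval v q = 0 := by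
  obtain ⟨r, rfl⟩ := h
  rw [map_mul, hp, zero_mul]

/-! ### The form `rPoly A c`. -/

namespace WeightedNumericalRange

/-- The product is symmetric in the eigenvalues, hence a function of the coefficients of the
characteristic polynomial. Any listing of the eigenvalues may therefore be used, such as a rescaled
or a sorted one. -/
theorem eval_cPoly {n : ℕ} {M : Matrix (Fin n) (Fin n) ℂ} (c : Fin n → ℝ) {l : Fin n → ℂ}
    (hl : M.charpoly = ∏ j, (Polynomial.X - Polynomial.C (l j))) (t : ℂ) :
    (cPoly M c).eval t = ∏ w ∈ arrangements c, (t - ∑ j, (w j : ℂ) * l j) := by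
  obtain ⟨q, hq⟩ := exists_symmetric_expression c (fun u => (u : ℂ)) t
  have key : ∀ l' : Fin n → ℂ, M.charpoly = ∏ j, (Polynomial.X - Polynomial.C (l' j)) →
      MvPolynomial.eval (fun i : Fin n => (-1) ^ (i.val + 1) *
        M.charpoly.coeff (n - (i.val + 1))) q =
          ∏ w ∈ arrangements c, (t - ∑ j, (w j : ℂ) * l' j) := by
    intro l' hl'
    have h := map_eval_charpoly_coeff (RingHom.id ℂ) M l' (by simpa using hl') q
    rw [RingHom.id_apply, hq, ← MvPolynomial.coe_eval₂Hom, map_prod] at h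
    rw [h]
    exact Finset.prod_congr rfl fun w _ => by simp
  rw [← key l hl, key _ (exists_eigenvalues M).choose_spec, cPoly, Polynomial.eval_prod]
  exact Finset.prod_congr rfl fun w _ => by
    rw [Polynomial.eval_sub, Polynomial.eval_X, Polynomial.eval_C]; rfl

theorem isCValue_iff {n : ℕ} (M : Matrix (Fin n) (Fin n) ℂ) (c : Fin n → ℝ) (z : ℂ) :
    IsCValue M c z ↔ (cPoly M c).eval z = 0 := by
  rw [IsCValue, cPoly, Polynomial.eval_prod, Finset.prod_eq_zero_iff]
  simp only [Polynomial.eval_sub, Polynomial.eval_X, Polynomial.eval_C, sub_eq_zero]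

theorem isCValue_iff_eval_rPoly {n : ℕ} (A : Matrix (Fin n) (Fin n) ℂ) (c : Fin n → ℝ) (z : ℂ) :
    IsCValue A c z ↔ MvPolynomial.eval ![1, 0, z] (rPoly A c) = 0 := by
  rw [isCValue_iff, rPoly_eval, one_smul, zero_smul, add_zero]

theorem cDeg_eq_card {n : ℕ} (A : Matrix (Fin n) (Fin n) ℂ) (c : Fin n → ℝ) :
    cDeg A c = (arrangements c).card := by
  rw [cDeg, cPoly, Polynomial.natDegree_prod_of_monic _ _ fun w _ => Polynomial.monic_X_sub_C _]
  simp only [Polynomial.natDegree_X_sub_C, Finset.sum_const, smul_eq_mul, mul_one]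

theorem rPoly_isHomogeneous {n : ℕ} (A : Matrix (Fin n) (Fin n) ℂ) (c : Fin n → ℝ) :
    (rPoly A c).IsHomogeneous (cDeg A c) := by
  refine MvPolynomial.isHomogeneous_of_eval_smul fun a ha v => ?_
  have hv : v = ![v 0, v 1, v 2] := by ext i; fin_cases i <;> rfl
  have hav : a • v = ![a * v 0, a * v 1, a * v 2] := by ext i; fin_cases i <;> rfl
  have hl := (exists_eigenvalues (v 0 • A + v 1 • Aᴴ)).choose_spec
  rw [hav, rPoly_eval, mul_smul, mul_smul, ← smul_add,
    eval_cPoly c (Matrix.charpoly_smul_eq_prod hl ha)]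
  conv_rhs => rw [hv, rPoly_eval, eval_cPoly c hl, cDeg_eq_card, ← Finset.prod_const,
    ← Finset.prod_mul_distrib]
  refine Finset.prod_congr rfl fun w _ => ?_
  rw [mul_sub, Finset.mul_sum]
  congr 1
  exact Finset.sum_congr rfl fun j _ => by ring

theorem eval_rPoly_zero_zero_one {n : ℕ} (A : Matrix (Fin n) (Fin n) ℂ) (c : Fin n → ℝ) :
    MvPolynomial.eval ![0, 0, 1] (rPoly A c) = 1 := by
  rw [rPoly_eval, zero_smul, zero_smul, add_zero, eval_cPoly c (l := fun _ => 0)]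
  · simp
  · simp

theorem rPoly_ne_zero {n : ℕ} (A : Matrix (Fin n) (Fin n) ℂ) (c : Fin n → ℝ) :
    rPoly A c ≠ 0 := fun h => by
  simpa [h] using eval_rPoly_zero_zero_one A c

theorem self_mem_arrangements {n : ℕ} (c : Fin n → ℝ) : c ∈ arrangements c :=
  Finset.mem_image.2 ⟨1, Finset.mem_univ _, rfl⟩

/-! ### Lines as zeros of the form. -/

theorem charpoly_eq_prod_sortedEigenvalue {n : ℕ} {H : Matrix (Fin n) (Fin n) ℂ}
    (hH : H.IsHermitian) :
    H.charpoly = ∏ j, (Polynomial.X - Polynomial.C (sortedEigenvalue hH j : ℂ)) := by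
  rw [hH.charpoly_eq]
  refine Fintype.prod_equiv
    ((Fintype.equivOfCardEq (Fintype.card_fin _)).symm.trans (finCongr (Fintype.card_fin n)))
    _ _ fun j => ?_
  rfl

/-- The point of the projective plane, in the chart `x = 1`, dual to the
line `weightedLine A c θ`. -/
noncomputable def dualPoint (θ h : ℝ) : Fin 3 → ℂ :=
  ![1, Complex.exp (-(2 * (Complex.I * θ))), 2 * Complex.exp (-(Complex.I * θ)) * h]

theorem eval_dualPoint_rPoly {n : ℕ} (A : Matrix (Fin n) (Fin n) ℂ) (c : Fin n → ℝ) (θ : ℝ) :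
    MvPolynomial.eval (dualPoint θ (weightedSupport A c θ)) (rPoly A c) = 0 := by
  have h1 : dualPoint θ (weightedSupport A c θ) = (2 * Complex.exp (-(Complex.I * θ))) •
      ![1 / 2 * Complex.exp (Complex.I * θ), 1 / 2 * Complex.exp (-(Complex.I * θ)),
        (weightedSupport A c θ : ℂ)] := by
    have h2 : Complex.exp (-(Complex.I * θ)) * Complex.exp (Complex.I * θ) = 1 := by
      rw [← Complex.exp_add, neg_add_cancel, Complex.exp_zero]
    have h3 : Complex.exp (-(2 * (Complex.I * θ))) =
        Complex.exp (-(Complex.I * θ)) * Complex.exp (-(Complex.I * θ)) := by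
      rw [← Complex.exp_add]; ring_nf
    ext i
    fin_cases i
    · simp only [dualPoint, Fin.zero_eta, Matrix.cons_val_zero, Pi.smul_apply, smul_eq_mul]
      linear_combination -h2
    · simp only [dualPoint, Fin.mk_one, Matrix.cons_val_one, Matrix.cons_val_zero, Pi.smul_apply,
        smul_eq_mul]
      linear_combination h3
    · simp [dualPoint]
  have h4 : (1 / 2 * Complex.exp (Complex.I * θ)) • A +
      (1 / 2 * Complex.exp (-(Complex.I * θ))) • Aᴴ = rotatedRealPart A θ := by
    rw [rotatedRealPart, smul_add, smul_smul, smul_smul]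
  rw [h1, (rPoly_isHomogeneous A c).eval_smul, rPoly_eval, h4,
    eval_cPoly c (charpoly_eq_prod_sortedEigenvalue (rotatedRealPart_isHermitian A θ)),
    -- With the eigenvalues in decreasing order, the factor of the arrangement `c` itself vanishes.
    Finset.prod_eq_zero (self_mem_arrangements c), mul_zero]
  simp [weightedSupport]

/-- The coordinate $e^{-2i\theta}$ determines $e^{i\theta}$ up to sign. If the sign changes, the
last coordinate forces the support value to change sign too, and the equation of the line is only
negated. -/
theorem weightedLine_eq_of_dualPoint_eq {n : ℕ} (A : Matrix (Fin n) (Fin n) ℂ) (c : Fin n → ℝ)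
    {θ θ' : ℝ} (h : dualPoint θ (weightedSupport A c θ) = dualPoint θ' (weightedSupport A c θ')) :
    weightedLine A c θ = weightedLine A c θ' := by
  set e := Complex.exp (Complex.I * θ) with he
  set e' := Complex.exp (Complex.I * θ') with he'
  have e0 : e ≠ 0 := Complex.exp_ne_zero _
  have e0' : e' ≠ 0 := Complex.exp_ne_zero _
  have h1 := congrFun h 1
  have h2 := congrFun h 2
  simp only [dualPoint, Matrix.cons_val_one, Matrix.cons_val_zero, Matrix.cons_val] at h1 h2
  rw [Complex.exp_neg, Complex.exp_neg, two_mul, two_mul, Complex.exp_add, Complex.exp_add,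
    ← he, ← he', inv_inj, mul_self_eq_mul_self_iff] at h1
  rw [Complex.exp_neg, Complex.exp_neg, ← he, ← he'] at h2
  ext v
  simp only [weightedLine, Set.mem_ofPred_eq, ← he, ← he']
  rcases h1 with h1 | h1
  · rw [h1] at h2 ⊢
    have h3 : (weightedSupport A c θ : ℂ) = weightedSupport A c θ' := by
      field_simp at h2; exact h2
    rw [Complex.ofReal_inj.1 h3]
  · rw [h1] at h2 ⊢
    have h3 : (weightedSupport A c θ : ℂ) = ((-weightedSupport A c θ' : ℝ) : ℂ) := by
      field_simp at h2; push_cast; linear_combination -h2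
    rw [Complex.ofReal_inj.1 h3, neg_mul, Complex.neg_re, neg_inj]

end WeightedNumericalRange

/-! ### The main theorem. -/

open WeightedNumericalRange in
theorem mainTheorem1 (n m : ℕ) (A : Matrix (Fin n) (Fin n) ℂ) (B : Matrix (Fin m) (Fin m) ℂ)
    (c : Fin n → ℝ) (d : Fin m → ℝ) (Θ : Finset ℝ)
    (hΘ : ∀ θ ∈ Θ, θ ∈ Set.Ico 0 (2 * Real.pi))
    (hcard : Θ.card = cDeg A c * cDeg B d + 1)
    (heq : ∀ θ ∈ Θ, weightedSupport A c θ = weightedSupport B d θ)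
    (hline : Set.InjOn (weightedLine A c) (Θ : Set ℝ)) :
    (∃ z : ℂ, IsCValue A c z ∧ IsCValue B d z) ∧
      (Irreducible (rPoly A c) → ∀ z : ℂ, IsCValue A c z → IsCValue B d z) := by
  classical
  have hrel : ¬ IsRelPrime (rPoly A c) (rPoly B d) := by
    intro hrel
    have hinj : Set.InjOn (fun θ => dualPoint θ (weightedSupport A c θ)) (Θ : Set ℝ) :=
      fun θ hθ θ' hθ' h => hline hθ hθ' (weightedLine_eq_of_dualPoint_eq A c h)
    have hle := MvPolynomial.card_common_zeros_le_mul_of_isRelPrime (rPoly_isHomogeneous A c)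
      (rPoly_isHomogeneous B d) (rPoly_ne_zero A c) (rPoly_ne_zero B d) hrel
      (Θ.image fun θ => dualPoint θ (weightedSupport A c θ))
      (Finset.forall_mem_image.2 fun θ _ => rfl)
      (Finset.forall_mem_image.2 fun θ _ => eval_dualPoint_rPoly A c θ)
      (Finset.forall_mem_image.2 fun θ hθ => by rw [heq θ hθ]; exact eval_dualPoint_rPoly B d θ)
    rw [Finset.card_image_of_injOn hinj] at hle
    omega
  constructor
  · rw [IsRelPrime] at hrel
    push Not at hrel
    obtain ⟨h, hA, hB, hu⟩ := hrel
    obtain ⟨z, hz⟩ := MvPolynomial.exists_eval_eq_zero_of_dvd (rPoly_isHomogeneous A c)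
      (by rw [eval_rPoly_zero_zero_one]; exact one_ne_zero) hA hu
    refine ⟨z, (isCValue_iff_eval_rPoly A c z).2 ?_, (isCValue_iff_eval_rPoly B d z).2 ?_⟩
    · exact MvPolynomial.eval_eq_zero_of_dvd hA hz
    · exact MvPolynomial.eval_eq_zero_of_dvd hB hz
  · intro hirr z hz
    have hdvd : rPoly A c ∣ rPoly B d := by
      by_contra h
      exact hrel (hirr.isRelPrime_iff_not_dvd.2 h)
    rw [isCValue_iff_eval_rPoly] at hz ⊢
    exact MvPolynomial.eval_eq_zero_of_dvd hdvd hz
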